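/- Let $m \geqslant 3$. Let $\mathcal{RM}(m-3,m)$ be the Reed--Muller code of order $m-3$ in $m$ variables, that is, the set of all Boolean functions $f:\mathbb{F}_2^m\to\mathbb{F}_2$ whose algebraic normal form has degree at most $m-3$, viewed as a subset of the space $\mathbb{F}_2^{2^m}$ of value vectors with the Hamming distance $d$. For a nonempty set $X\subseteq\mathbb{F}_2^{2^m}$ put $d(y,X)=\min_{x\in X}d(y,x)$ and $\rho(X)=\max_{z}d(z,X)$, where $z$ ranges over $\mathbb{F}_2^{2^m}$, and let $\widehat{X}=\{y\in\mathbb{F}_2^{2^m} : d(y,X)=\rho(X)\}$ be the metric complement of $X$. Then $\mathcal{RM}(m-3,m)$ is metrically regular, that is, $$\widehat{\widehat{\mathcal{RM}(m-3,m)}}=\mathcal{RM}(m-3,m).$$ -/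

import Mathlib

/-! ### Metric complements and metric regularity in the Boolean cube -/

section MetricRegularity

variable {ι : Type*} [Fintype ι] [DecidableEq ι]

/-- The distance `d(y, X) = min_{x ∈ X} d(y, x)` from a binary vector `y` to a set `X` of binary
vectors, for the Hamming metric. The minimum is attained as soon as `X` is nonempty. -/
noncomputable def distToSet (y : ι → ZMod 2) (X : Set (ι → ZMod 2)) : ℕ :=
  sInf ((fun x => hammingDist y x) '' X)

/-- The covering radius `ρ(X) = max_z d(z, X)`. -/
noncomputable def coveringRadius (X : Set (ι → ZMod 2)) : ℕ :=
  Finset.univ.sup fun z : ι → ZMod 2 => distToSet z X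

/-- The metric complement of `X`: all vectors at the maximal possible distance from `X`. -/
def metricComplement (X : Set (ι → ZMod 2)) : Set (ι → ZMod 2) :=
  {y | distToSet y X = coveringRadius X}

/-- `X` is metrically regular if its second metric complement is `X` itself. -/
def MetricallyRegular (X : Set (ι → ZMod 2)) : Prop :=
  metricComplement (metricComplement X) = X

end MetricRegularity

/-! ### Boolean functions, algebraic normal form, Reed-Muller codes -/

/-- Boolean functions in `m` variables. Such a function is its own value vector, the `2 ^ m`
coordinates being indexed by the points of `𝔽₂ᵐ`. -/
abbrev BoolFun (m : ℕ) : Type := (Fin m → ZMod 2) → ZMod 2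

/-- The Boolean function `x ↦ ∑_S a_S ∏_{i ∈ S} x_i` with the coefficients `a`. -/
def anfEval {m : ℕ} (a : Finset (Fin m) → ZMod 2) : BoolFun m :=
  fun x => ∑ S : Finset (Fin m), a S * ∏ i ∈ S, x i

theorem anfEval_injective (m : ℕ) :
    Function.Injective (anfEval : (Finset (Fin m) → ZMod 2) → BoolFun m) := by
  intro a b h
  funext S
  induction S using Finset.strongInduction with
  | H S ih =>
    have key : ∀ c : Finset (Fin m) → ZMod 2,
        anfEval c (fun i => if i ∈ S then 1 else 0) = c S + ∑ T ∈ S.ssubsets, c T := by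
      intro c
      have h1 : ∀ T : Finset (Fin m),
          c T * ∏ i ∈ T, (if i ∈ S then (1 : ZMod 2) else 0) = if T ⊆ S then c T else 0 := by
        intro T
        rw [Finset.prod_ite_zero]
        simp [Finset.subset_iff]
      have h2 : (Finset.univ.filter fun T : Finset (Fin m) => T ⊆ S) = insert S S.ssubsets := by
        ext T
        simp only [Finset.mem_filter, Finset.mem_univ, true_and, Finset.mem_insert,
          Finset.mem_ssubsets]
        exact le_iff_eq_or_lt (a := T) (b := S)
      simp only [anfEval, h1]
      rw [← Finset.sum_filter, h2, Finset.sum_insert (by simp)]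
    have h3 := congrFun h (fun i => if i ∈ S then 1 else 0)
    rw [key, key, Finset.sum_congr rfl fun T hT => ih T (Finset.mem_ssubsets.mp hT)] at h3
    exact add_right_cancel h3

/-- Every Boolean function has exactly one algebraic normal form. -/
theorem existsUnique_anf {m : ℕ} (f : BoolFun m) :
    ∃! a : Finset (Fin m) → ZMod 2, anfEval a = f := by
  have hb : Function.Bijective (anfEval : (Finset (Fin m) → ZMod 2) → BoolFun m) := by
    rw [Fintype.bijective_iff_injective_and_card]
    exact ⟨anfEval_injective m, by simp⟩
  exact hb.existsUnique f

/-- The coefficients of the algebraic normal form of `f`. -/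
noncomputable def anf {m : ℕ} (f : BoolFun m) : Finset (Fin m) → ZMod 2 :=
  (existsUnique_anf f).choose

/-- The degree of the algebraic normal form of `f`: the largest number of variables in a monomial
that occurs in it (and `0` for the zero function). -/
noncomputable def anfDegree {m : ℕ} (f : BoolFun m) : ℕ :=
  (Finset.univ.filter fun S : Finset (Fin m) => anf f S ≠ 0).sup Finset.card

/-- The Reed-Muller code of order `k` in `m` variables. -/
def reedMuller (k m : ℕ) : Set (BoolFun m) :=
  {f | anfDegree f ≤ k}

/-! The code is dual to the quadratic functions, so a coset is determined by a syndrome: the parity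
of `f` and the symmetric matrix `∑_{f x = 1} x xᵀ` (`mem_reedMuller_iff`). The distance from `f` to
the code is the least number of points with the same syndrome.

The covering radius is `2 * (m / 2) + 2`. Writing symmetric matrices as sums of squares `x xᵀ` gives
the upper bound, strict for odd parity (`distToSet_reedMuller_le`). Even functions with an
alternating matrix of rank `2 * (m / 2)` attain it (`le_hammingNorm_of_secondMoment`).

For a linear code, the second metric complement is the group `H` of translations preserving the set
of deep holes. Here `H` contains only even functions, and its matrices form a group invariant under
congruence by transvections. If one of them were nonzero, this group would contain an alternating
matrix of maximal rank, so some `g ∈ H` would be a deep hole; then so would `g + g = 0`, which is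
absurd. -/

/-! ### Duality of Reed-Muller codes and syndromes. -/

theorem mem_reedMuller_iff_anf {k m : ℕ} {f : BoolFun m} :
    f ∈ reedMuller k m ↔ ∀ S : Finset (Fin m), k < S.card → anf f S = 0 := by
  simp only [reedMuller, Set.mem_ofPred_eq, anfDegree, Finset.sup_le_iff, Finset.mem_filter,
    Finset.mem_univ, true_and]
  exact forall_congr' fun S => by rw [← not_imp_not, not_le, not_not]

theorem anfEval_anf {m : ℕ} (f : BoolFun m) : anfEval (anf f) = f :=
  (existsUnique_anf f).choose_spec.1

/-- The inner product of `f` with the monomial `∏_{i ∈ T} x_i`. -/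
def moment {m : ℕ} (f : BoolFun m) (T : Finset (Fin m)) : ZMod 2 :=
  ∑ x, f x * ∏ i ∈ T, x i

theorem ZMod.mul_self_two (a : ZMod 2) : a * a = a := by revert a; decide

theorem prod_mul_prod_eq_prod_union {m : ℕ} (S T : Finset (Fin m)) (x : Fin m → ZMod 2) :
    (∏ i ∈ S, x i) * ∏ i ∈ T, x i = ∏ i ∈ S ∪ T, x i := by
  have h : ∏ i ∈ S ∪ T, x i = (∏ i ∈ (S ∪ T) \ (S ∩ T), x i) * ∏ i ∈ S ∩ T, x i :=
    (Finset.prod_sdiff (Finset.inter_subset_left.trans Finset.subset_union_left)).symm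
  rw [← Finset.prod_union_inter, h, mul_assoc, ZMod.mul_self_two]

theorem sum_prod_monomial {m : ℕ} (U : Finset (Fin m)) :
    ∑ x : Fin m → ZMod 2, ∏ i ∈ U, x i = if U = Finset.univ then 1 else 0 := by
  have h1 : ∀ x : Fin m → ZMod 2, ∏ i ∈ U, x i = ∏ i, if i ∈ U then x i else 1 := by
    intro x; simp
  have h2 : ∀ i, ∑ t : ZMod 2, (if i ∈ U then t else 1) = if i ∈ U then 1 else 0 := by
    intro i
    by_cases h : i ∈ U
    · simp only [h, if_true]; decide
    · simp only [h, if_false]; decide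
  simp only [h1]
  rw [← Fintype.piFinset_univ,
    Finset.sum_prod_piFinset Finset.univ fun i (t : ZMod 2) => if i ∈ U then t else 1]
  simp only [h2, Finset.prod_ite_zero, Finset.prod_const_one, Finset.eq_univ_iff_forall,
    Finset.mem_univ, true_imp_iff]

theorem moment_eq_sum_anf {m : ℕ} (f : BoolFun m) (T : Finset (Fin m)) :
    moment f T = ∑ S, if S ∪ T = Finset.univ then anf f S else 0 := by
  have h : ∀ x, f x = ∑ S : Finset (Fin m), anf f S * ∏ i ∈ S, x i := fun x =>
    (congrFun (anfEval_anf f) x).symm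
  simp only [moment]
  simp only [h, Finset.sum_mul, mul_assoc, prod_mul_prod_eq_prod_union]
  rw [Finset.sum_comm]
  simp only [← Finset.mul_sum, sum_prod_monomial, mul_ite, mul_one, mul_zero]

/-- The moment at `T` is the sum of the coefficients over all `S ⊇ Tᶜ`. This system is triangular,
so induction on `T` recovers the coefficient at `Tᶜ`. -/
theorem mem_reedMuller_iff_moment {k l m : ℕ} (h : k + l + 1 = m) {f : BoolFun m} :
    f ∈ reedMuller k m ↔ ∀ T : Finset (Fin m), T.card ≤ l → moment f T = 0 := by
  rw [mem_reedMuller_iff_anf]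
  constructor
  · intro hf T hT
    rw [moment_eq_sum_anf]
    refine Finset.sum_eq_zero fun S _ => ?_
    split_ifs with hS
    · refine hf S ?_
      have := Finset.card_union_le S T
      rw [hS, Finset.card_univ, Fintype.card_fin] at this
      omega
    · rfl
  · intro hf
    have key : ∀ T : Finset (Fin m), T.card ≤ l → anf f Tᶜ = 0 := by
      intro T
      induction T using Finset.strongInduction with
      | H T ih =>
        intro hT
        have h1 := hf T hT
        rw [moment_eq_sum_anf, Finset.sum_eq_single Tᶜ] at h1
        · rwa [if_pos (by rw [Finset.union_comm, Finset.union_compl])] at h1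
        · intro S _ hS
          split_ifs with hU
          · have hsub : Sᶜ ⊆ T := by
              intro i hi
              have : i ∈ S ∪ T := hU ▸ Finset.mem_univ i
              rcases Finset.mem_union.mp this with h | h
              · exact absurd h (Finset.mem_compl.mp hi)
              · exact h
            have hne : Sᶜ ≠ T := fun h => hS (by rw [← h, compl_compl])
            have := ih Sᶜ (hsub.ssubset_of_ne hne) ((Finset.card_le_card hsub).trans hT)
            rwa [compl_compl] at this
          · rfl
        · simp
    intro S hS
    have := key Sᶜ (by rw [Finset.card_compl, Fintype.card_fin]; omega)
    rwa [compl_compl] at this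

/-- The parity of the weight of `f`. -/
def parity {m : ℕ} (f : BoolFun m) : ZMod 2 := ∑ x, f x

/-- The matrix `∑_{f x = 1} x xᵀ`. -/
def secondMoment {m : ℕ} (f : BoolFun m) (a b : Fin m) : ZMod 2 := ∑ x, f x * (x a * x b)

/-- Monomials of degree one are covered by the diagonal, since `x_a * x_a = x_a`. -/
theorem mem_reedMuller_iff {m : ℕ} (hm : 3 ≤ m) {f : BoolFun m} :
    f ∈ reedMuller (m - 3) m ↔ parity f = 0 ∧ ∀ a b, secondMoment f a b = 0 := by
  rw [mem_reedMuller_iff_moment (l := 2) (by omega)]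
  constructor
  · intro h
    refine ⟨by simpa [moment, parity] using h ∅ (by simp), fun a b => ?_⟩
    have h1 := h ({a} ∪ {b}) ((Finset.card_union_le _ _).trans (by simp))
    simpa only [moment, secondMoment, ← prod_mul_prod_eq_prod_union, Finset.prod_singleton]
      using h1
  · rintro ⟨h0, h⟩ T hT
    interval_cases hc : T.card
    · rw [Finset.card_eq_zero] at hc
      simpa [moment, parity, hc] using h0
    · obtain ⟨a, rfl⟩ := Finset.card_eq_one.mp hc
      simpa [moment, secondMoment, ZMod.mul_self_two] using h a a
    · obtain ⟨a, b, hab, rfl⟩ := Finset.card_eq_two.mp hc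
      simpa [moment, secondMoment, Finset.prod_pair hab] using h a b

theorem parity_add {m : ℕ} (f g : BoolFun m) : parity (f + g) = parity f + parity g := by
  simp [parity, Finset.sum_add_distrib]

theorem secondMoment_add {m : ℕ} (f g : BoolFun m) (a b : Fin m) :
    secondMoment (f + g) a b = secondMoment f a b + secondMoment g a b := by
  simp [secondMoment, Finset.sum_add_distrib, add_mul]

theorem secondMoment_comm {m : ℕ} (f : BoolFun m) (a b : Fin m) :
    secondMoment f a b = secondMoment f b a := by
  simp only [secondMoment, mul_comm]

/-! ### Symmetric matrices over `𝔽₂` as sums of squares. -/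

/-- If a symmetric matrix `A` vanishes outside `S × S`, then `A + v vᵀ` is a sum of few matrices
`x xᵀ`. -/
theorem exists_sum_squares {m : ℕ} (n : ℕ) (S : Finset (Fin m)) (hS : S.card ≤ n)
    (A : Fin m → Fin m → ZMod 2) (hA : ∀ a b, A a b = A b a) (hAS : ∀ a b, a ∉ S → A a b = 0)
    (v : Fin m → ZMod 2) :
    ∃ L : List (Fin m → ZMod 2), L.length ≤ n + 1 ∧
      ((∀ a, A a a = 0) → L.length ≤ 2 * (n / 2) + 1) ∧
      ∀ a b, A a b + v a * v b = (L.map fun x => x a * x b).sum := by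
  induction n using Nat.strong_induction_on generalizing S A v with
  | _ n ih =>
    have two : (2 : ZMod 2) = 0 := rfl
    have ne : ∀ t : ZMod 2, t ≠ 0 → t = 1 := by decide
    by_cases hdiag : ∀ a, A a a = 0
    · by_cases hzero : ∀ a b, A a b = 0
      · exact ⟨[v], by simp, by simp, by simp [hzero]⟩
      · push Not at hzero
        obtain ⟨i, j, hij⟩ := hzero
        have hij1 := ne _ hij
        have hiS : i ∈ S := by by_contra h; exact hij (hAS i j h)
        have hjS : j ∈ S := by by_contra h; exact hij (by rw [hA, hAS j i h])
        have hne : i ≠ j := by rintro rfl; exact hij (hdiag i)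
        have hcard : (S.erase i).card + 1 = S.card := Finset.card_erase_add_one hiS
        have hcard' : ((S.erase i).erase j).card + 1 = (S.erase i).card :=
          Finset.card_erase_add_one (Finset.mem_erase.mpr ⟨hne.symm, hjS⟩)
        -- Split off a hyperbolic plane. For the columns `p`, `q` of `A` at `i`, `j`, the matrix
        -- `pqᵀ + qpᵀ + vvᵀ` is the sum of the squares of `v + p`, `v + q` and `v + p + q`; the last
        -- vector replaces `v`, so two coordinates cost two squares.
        obtain ⟨L, -, hL, hsum⟩ := ih (n - 2) (by omega) ((S.erase i).erase j) (by omega)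
          (fun a b => A a b + A a i * A b j + A a j * A b i)
          (fun a b => by simp only [hA a b]; ring)
          (fun a b ha => by
            simp only [Finset.mem_erase, not_and_or, not_not] at ha
            rcases ha with rfl | rfl | ha
            · simp only [hdiag, hA a i, hij1, hA b a]; linear_combination A a b * two
            · simp only [hdiag, hij1, hA b a]; linear_combination A a b * two
            · simp only [hAS a _ ha]; ring) (fun a => v a + A a i + A a j)
        have hlen := hL fun a => by
          simp only [hdiag]; linear_combination A a i * A a j * two
        refine ⟨(fun a => v a + A a i) :: (fun a => v a + A a j) :: L, ?_, fun _ => ?_,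
          fun a b => ?_⟩
        · simp only [List.length_cons]; omega
        · simp only [List.length_cons]; omega
        · simp only [List.map_cons, List.sum_cons, ← hsum a b]
          linear_combination
            (-(v a + A a i + A a j) * (v b + A b i + A b j)) * two
    · push Not at hdiag
      obtain ⟨i, hi⟩ := hdiag
      have hi1 := ne _ hi
      have hiS : i ∈ S := by by_contra h; exact hi (hAS i i h)
      have hcard : (S.erase i).card + 1 = S.card := Finset.card_erase_add_one hiS
      obtain ⟨L, hL, -, hsum⟩ := ih (n - 1) (by omega) (S.erase i) (by omega)
        (fun a b => A a b + A a i * A b i) (fun a b => by simp only [hA a b]; ring)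
        (fun a b ha => by
          simp only [Finset.mem_erase, not_and_or, not_not] at ha
          rcases ha with rfl | ha
          · simp only [hi1, hA b a]; linear_combination A a b * two
          · simp only [hAS a _ ha]; ring) v
      refine ⟨(fun a => A a i) :: L, ?_, fun h => absurd (h i) hi, fun a b => ?_⟩
      · simp only [List.length_cons]; omega
      · simp only [List.map_cons, List.sum_cons, ← hsum a b]
        linear_combination (-A a i * A b i) * two

theorem exists_sum_squares_of_symm {m : ℕ} (A : Fin m → Fin m → ZMod 2)
    (hA : ∀ a b, A a b = A b a) :
    ∃ L : List (Fin m → ZMod 2), L.length ≤ 2 * (m / 2) + 1 ∧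
      ∀ a b, A a b = (L.map fun x => x a * x b).sum := by
  have two : (2 : ZMod 2) = 0 := rfl
  have ne : ∀ t : ZMod 2, t ≠ 0 → t = 1 := by decide
  by_cases hdiag : ∀ a, A a a = 0
  · obtain ⟨L, -, hL, hsum⟩ := exists_sum_squares m Finset.univ (by simp) A hA (by simp) 0
    exact ⟨L, hL hdiag, fun a b => by simpa using hsum a b⟩
  · push Not at hdiag
    obtain ⟨i, hi⟩ := hdiag
    have hi1 := ne _ hi
    have hm : 0 < m := i.pos
    -- Taking column `i` as `v` restores the square split off from `A`, so `m` squares suffice.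
    obtain ⟨L, hL, -, hsum⟩ := exists_sum_squares (m - 1) (Finset.univ.erase i) (by simp)
        (fun a b => A a b + A a i * A b i) (fun a b => by simp only [hA a b]; ring)
        (fun a b ha => by
          simp only [Finset.mem_erase, Finset.mem_univ, and_true, not_not] at ha
          subst ha
          simp only [hi1, hA b a]; linear_combination A a b * two) (fun a => A a i)
    refine ⟨L, by omega, fun a b => ?_⟩
    rw [← hsum a b]
    linear_combination (-A a i * A b i) * two

theorem hammingNorm_add_le {m : ℕ} (f g : BoolFun m) :
    hammingNorm (f + g) ≤ hammingNorm f + hammingNorm g := by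
  have h := hammingDist_triangle 0 f (f + g)
  rwa [hammingDist_zero_left, hammingDist_eq_hammingNorm f,
    neg_add_cancel_left] at h

/-- Every parity and symmetric matrix are those of a function of small weight. -/
theorem exists_parity_secondMoment {m : ℕ} (ε : ZMod 2) (A : Fin m → Fin m → ZMod 2)
    (hA : ∀ a b, A a b = A b a) :
    ∃ f : BoolFun m, parity f = ε ∧ (∀ a b, secondMoment f a b = A a b) ∧
      hammingNorm f ≤ 2 * (m / 2) + 2 ∧ (ε = 1 → hammingNorm f < 2 * (m / 2) + 2) := by
  have key : ∀ L : List (Fin m → ZMod 2), ∃ f : BoolFun m, parity f = L.length ∧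
      (∀ a b, secondMoment f a b = (L.map fun x => x a * x b).sum) ∧
      hammingNorm f ≤ L.length := by
    intro L
    induction L with
    | nil => exact ⟨0, by simp [parity], by simp [secondMoment], by simp⟩
    | cons x L ih =>
      obtain ⟨f, h1, h2, h3⟩ := ih
      refine ⟨Pi.single x 1 + f, ?_, fun a b => ?_, ?_⟩
      · rw [parity_add, h1]; simp [parity, add_comm]
      · rw [secondMoment_add, h2]; simp [secondMoment, Pi.single_apply]
      · have h4 : hammingNorm (Pi.single x 1 : BoolFun m) ≤ 1 := by
          refine (Finset.card_le_card (t := {x}) fun y hy => ?_).trans (by simp)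
          by_contra h
          simp_all
        exact (hammingNorm_add_le _ _).trans (by simp only [List.length_cons]; omega)
  obtain ⟨L, hL, hsum⟩ := exists_sum_squares_of_symm A hA
  have : ∃ L : List (Fin m → ZMod 2), (L.length : ZMod 2) = ε ∧ L.length ≤ 2 * (m / 2) + 2 ∧
      ∀ a b, A a b = (L.map fun x => x a * x b).sum := by
    by_cases h : (L.length : ZMod 2) = ε
    · exact ⟨L, h, by omega, hsum⟩
    -- The point `0` flips the parity and leaves the matrix unchanged.
    · refine ⟨0 :: L, ?_, by simpa using hL, by simpa using hsum⟩
      have : ∀ s t : ZMod 2, s ≠ t → s + 1 = t := by decide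
      simpa using this _ _ h
  obtain ⟨L, h1, h2, h3⟩ := this
  obtain ⟨f, hf1, hf2, hf3⟩ := key L
  refine ⟨f, hf1.trans h1, fun a b => (hf2 a b).trans (h3 a b).symm, hf3.trans h2, ?_⟩
  rintro rfl
  refine lt_of_le_of_lt hf3 (lt_of_le_of_ne h2 fun h => ?_)
  rw [h] at h1
  push_cast at h1
  have two : (2 : ZMod 2) = 0 := rfl
  simp [two] at h1

/-! ### Metric complements of linear codes. -/

theorem distToSet_le {ι : Type*} [Fintype ι] {X : Set (ι → ZMod 2)} {x : ι → ZMod 2}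
    (hx : x ∈ X) (y : ι → ZMod 2) : distToSet y X ≤ hammingDist y x :=
  Nat.sInf_le ⟨x, hx, rfl⟩

theorem le_distToSet {ι : Type*} [Fintype ι] {X : Set (ι → ZMod 2)} (hX : X.Nonempty)
    {y : ι → ZMod 2} {n : ℕ} (h : ∀ x ∈ X, n ≤ hammingDist y x) : n ≤ distToSet y X := by
  obtain ⟨x, hx, hxy⟩ := Nat.sInf_mem (hX.image fun x => hammingDist y x)
  exact (h x hx).trans hxy.le

theorem coveringRadius_eq {ι : Type*} [Fintype ι] [DecidableEq ι] {X : Set (ι → ZMod 2)}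
    {n : ℕ} (h : ∀ y, distToSet y X ≤ n) {y : ι → ZMod 2} (hy : distToSet y X = n) :
    coveringRadius X = n :=
  le_antisymm (Finset.sup_le fun z _ => h z)
    (hy ▸ Finset.le_sup (f := fun z => distToSet z X) (Finset.mem_univ y))

theorem Pi.add_self_two {ι : Type*} (f : ι → ZMod 2) : f + f = 0 :=
  funext fun i => CharTwo.add_self_eq_zero (f i)

theorem hammingDist_eq_hammingNorm_add {ι : Type*} [Fintype ι] (f g : ι → ZMod 2) :
    hammingDist f g = hammingNorm (f + g) := by
  rw [hammingDist_eq_hammingNorm, neg_eq_of_add_eq_zero_left (Pi.add_self_two f)]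

theorem distToSet_add_left {ι : Type*} [Fintype ι] (C : AddSubgroup (ι → ZMod 2))
    {f : ι → ZMod 2} (hf : f ∈ C) (z : ι → ZMod 2) :
    distToSet (f + z) (C : Set (ι → ZMod 2)) = distToSet z (C : Set (ι → ZMod 2)) := by
  have key : ∀ z, distToSet (f + z) (C : Set (ι → ZMod 2)) ≤ distToSet z (C : Set (ι → ZMod 2)) := by
    refine fun z => le_distToSet ⟨0, C.zero_mem⟩ fun x hx => ?_
    refine (distToSet_le (C.add_mem hf hx) _).trans_eq ?_
    rw [hammingDist_eq_hammingNorm_add, hammingDist_eq_hammingNorm_add, add_add_add_comm,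
      Pi.add_self_two, zero_add]
  refine le_antisymm (key z) ?_
  have h := key (f + z)
  rwa [← add_assoc, Pi.add_self_two, zero_add] at h

/-- The second metric complement of a linear code is the stabilizer of its metric complement. -/
theorem metricComplement_metricComplement {ι : Type*} [Fintype ι] [DecidableEq ι]
    (C : AddSubgroup (ι → ZMod 2)) {n : ℕ} (hn : ∀ y, distToSet y (C : Set (ι → ZMod 2)) ≤ n)
    {y₀ : ι → ZMod 2} (hy₀ : distToSet y₀ (C : Set (ι → ZMod 2)) = n) :
    metricComplement (metricComplement (C : Set (ι → ZMod 2))) =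
      {f | ∀ z, distToSet z (C : Set (ι → ZMod 2)) = n →
        distToSet (f + z) (C : Set (ι → ZMod 2)) = n} := by
  have hC : (C : Set (ι → ZMod 2)).Nonempty := ⟨0, C.zero_mem⟩
  have hcr := coveringRadius_eq hn hy₀
  have hM : metricComplement (C : Set (ι → ZMod 2)) =
      {z | distToSet z (C : Set (ι → ZMod 2)) = n} := by
    simp only [metricComplement, hcr]
  rw [hM]
  set D : Set (ι → ZMod 2) := {z | distToSet z (C : Set (ι → ZMod 2)) = n} with hD
  have hdist : ∀ z, ∃ c ∈ C, hammingNorm (z + c) = distToSet z (C : Set (ι → ZMod 2)) := by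
    intro z
    obtain ⟨x, hx, hxz⟩ := Nat.sInf_mem (hC.image fun x => hammingDist z x)
    exact ⟨x, hx, (hammingDist_eq_hammingNorm_add z x).symm.trans hxz⟩
  have hge : ∀ z ∈ D, ∀ c ∈ C, n ≤ hammingNorm (z + c) := by
    intro z hz c hc
    rw [← hammingDist_eq_hammingNorm_add]
    exact hz.symm.le.trans (distToSet_le hc z)
  have hmem : ∀ z, (∀ c ∈ C, n ≤ hammingNorm (z + c)) → z ∈ D := by
    intro z h
    obtain ⟨c, hc, h1⟩ := hdist z
    exact le_antisymm (hn z) (h1 ▸ h c hc)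
  have hadd : ∀ z ∈ D, ∀ c ∈ C, z + c ∈ D := by
    intro z hz c hc
    refine hmem _ fun c' hc' => ?_
    rw [add_assoc]
    exact hge z hz _ (C.add_mem hc hc')
  -- A codeword `c` within `n` of `y + y₀` yields the deep hole `y₀ + c` within `n` of `y`.
  have hDle : ∀ y, distToSet y D ≤ n := by
    intro y
    obtain ⟨c, hc, h1⟩ := hdist (y + y₀)
    refine (distToSet_le (hadd y₀ hy₀ c hc) y).trans ?_
    rw [hammingDist_eq_hammingNorm_add, ← add_assoc, h1]
    exact hn _
  have hD0 : distToSet 0 D = n := by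
    refine le_antisymm (hDle 0) (le_distToSet ⟨y₀, hy₀⟩ fun z hz => ?_)
    rw [hammingDist_zero_left, ← add_zero z]
    exact hge z hz 0 C.zero_mem
  ext f
  simp only [metricComplement, coveringRadius_eq hDle hD0, Set.mem_ofPred_eq]
  constructor
  · intro hf z hz
    refine hmem _ fun c hc => ?_
    rw [add_assoc, ← hammingDist_eq_hammingNorm_add, ← hf]
    exact distToSet_le (hadd z hz c hc) f
  · intro hf
    refine le_antisymm (hDle f) (le_distToSet ⟨y₀, hy₀⟩ fun z hz => ?_)
    rw [hammingDist_eq_hammingNorm_add, ← add_zero (f + z)]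
    exact hge _ (hf z hz) 0 C.zero_mem

/-! ### The covering radius and its extremal functions. -/

/-- The Reed-Muller code of order `m - 3` as a subgroup. -/
def reedMullerSubgroup {m : ℕ} (hm : 3 ≤ m) : AddSubgroup (BoolFun m) where
  carrier := reedMuller (m - 3) m
  zero_mem' := by simp [mem_reedMuller_iff hm, parity, secondMoment]
  add_mem' hf hg := by
    rw [mem_reedMuller_iff hm] at *
    exact ⟨by rw [parity_add, hf.1, hg.1, add_zero], fun a b => by
      rw [secondMoment_add, hf.2, hg.2, add_zero]⟩
  neg_mem' {f} hf := by rwa [neg_eq_of_add_eq_zero_left (Pi.add_self_two f)]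

theorem distToSet_reedMuller_le {m : ℕ} (hm : 3 ≤ m) (f : BoolFun m) :
    distToSet f (reedMuller (m - 3) m) ≤ 2 * (m / 2) + 2 ∧
      (parity f = 1 → distToSet f (reedMuller (m - 3) m) < 2 * (m / 2) + 2) := by
  obtain ⟨g, h1, h2, h3, h4⟩ :=
    exists_parity_secondMoment (parity f) (secondMoment f) (secondMoment_comm f)
  have hmem : f + g ∈ reedMuller (m - 3) m := by
    rw [mem_reedMuller_iff hm]
    exact ⟨by rw [parity_add, h1, CharTwo.add_self_eq_zero], fun a b => by
      rw [secondMoment_add, h2, CharTwo.add_self_eq_zero]⟩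
  have hle : distToSet f (reedMuller (m - 3) m) ≤ hammingNorm g := by
    refine (distToSet_le hmem f).trans_eq ?_
    rw [hammingDist_eq_hammingNorm_add, ← add_assoc, Pi.add_self_two, zero_add]
  exact ⟨hle.trans h3, fun h => hle.trans_lt (h4 h)⟩

/-- A function of even weight whose second moment is `J - I` on an even number of coordinates,
and zero elsewhere, has large weight. -/
theorem le_hammingNorm_of_secondMoment {m : ℕ} (S : Finset (Fin m)) (hS : Even S.card)
    (hS0 : S.Nonempty) (f : BoolFun m) (hp : parity f = 0)
    (hf : ∀ a b, secondMoment f a b = if a ∈ S ∧ b ∈ S ∧ a ≠ b then 1 else 0) :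
    S.card + 2 ≤ hammingNorm f := by
  set D : Finset (Fin m → ZMod 2) := Finset.univ.filter fun x => f x ≠ 0 with hD
  have hsum : ∀ φ : (Fin m → ZMod 2) → ZMod 2, ∑ x, f x * φ x = ∑ x : D, φ x := by
    intro φ
    rw [Finset.sum_coe_sort D φ, hD, Finset.sum_filter]
    refine Finset.sum_congr rfl fun x _ => ?_
    have : ∀ s t : ZMod 2, s * t = if s ≠ 0 then t else 0 := by decide
    exact this _ _
  have hpar : ∑ _x : D, (1 : ZMod 2) = 0 := by
    rw [← hsum fun _ => 1, ← hp]; simp [parity]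
  have hone : ∀ a, ∑ x : D, x.1 a = 0 := by
    intro a
    rw [← hsum fun x => x a]
    simpa [secondMoment, ZMod.mul_self_two] using hf a a
  have htwo : ∀ a b, ∑ x : D, x.1 a * x.1 b = if a ∈ S ∧ b ∈ S ∧ a ≠ b then 1 else 0 := by
    intro a b
    rw [← hf, ← hsum fun x => x a * x b, secondMoment]
  obtain ⟨s₀, hs₀⟩ := hS0
  have hDne : Nonempty D := by
    by_contra h
    rw [not_nonempty_iff] at h
    obtain ⟨b, hb, hne⟩ : ∃ b ∈ S, b ≠ s₀ := by
      by_contra! h1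
      have : S = {s₀} := Finset.eq_singleton_iff_unique_mem.mpr ⟨hs₀, h1⟩
      rw [this] at hS
      simp at hS
    have := htwo b s₀
    simp [hb, hs₀, hne] at this
  let Φ : ((S → ZMod 2) × ZMod 2) →ₗ[ZMod 2] (D → ZMod 2) :=
    { toFun := fun p x => (∑ s : S, p.1 s * x.1 s) + p.2
      map_add' := fun p q => by
        ext x; simp only [Prod.fst_add, Prod.snd_add, Pi.add_apply, add_mul,
          Finset.sum_add_distrib]; ring
      map_smul' := fun c p => by
        ext x; simp only [Prod.smul_fst, Prod.smul_snd, Pi.smul_apply, smul_eq_mul, mul_assoc,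
          ← Finset.mul_sum, RingHom.id_apply]; ring }
  have hΦ : Function.Injective Φ := by
    rw [← LinearMap.ker_eq_bot, LinearMap.ker_eq_bot']
    rintro ⟨u, c⟩ h
    have h1 : ∀ x : D, (∑ s : S, u s * x.1 s) + c = 0 := fun x => congrFun h x
    -- Multiplying the relation by `x_t` and summing over the support `D` applies `J - I` to `u`;
    -- this matrix is invertible because `S.card` is even.
    have h2 : ∀ t : S, u t = ∑ s : S, u s := by
      intro t
      have h3 : ∑ x : D, ((∑ s : S, u s * x.1 s) + c) * x.1 t = 0 :=
        Finset.sum_eq_zero fun x _ => by rw [h1, zero_mul]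
      simp only [add_mul, Finset.sum_add_distrib, ← Finset.mul_sum, hone, mul_zero, add_zero,
        Finset.sum_mul] at h3
      rw [Finset.sum_comm] at h3
      simp only [mul_assoc, ← Finset.mul_sum, htwo] at h3
      have h4 : ∀ s : S, (u s * if s.1 ∈ S ∧ t.1 ∈ S ∧ s.1 ≠ t.1 then (1 : ZMod 2) else 0) =
          u s - if s = t then u s else 0 := by
        intro s
        by_cases hst : s = t
        · simp [hst]
        · have : s.1 ≠ t.1 := fun h => hst (Subtype.ext h)
          simp [hst, this]
      simp only [h4, Finset.sum_sub_distrib, Finset.sum_ite_eq', Finset.mem_univ, if_true] at h3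
      exact (sub_eq_zero.mp h3).symm
    have h5 : ∑ s : S, u s = 0 := by
      rw [Finset.sum_congr rfl fun s _ => h2 s, Finset.sum_const, Finset.card_univ,
        Fintype.card_coe, nsmul_eq_mul, (ZMod.natCast_eq_zero_iff_even).mpr hS, zero_mul]
    have h6 : u = 0 := funext fun t => (h2 t).trans h5
    have h7 := h1 hDne.some
    simp only [h6, Pi.zero_apply, zero_mul, Finset.sum_const_zero, zero_add] at h7
    rw [h6, h7]; rfl
  let σ : (D → ZMod 2) →ₗ[ZMod 2] ZMod 2 := ∑ x : D, LinearMap.proj x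
  have hσ : ∀ φ, σ φ = ∑ x, φ x := fun φ => by simp [σ]
  -- The image of `Φ`, of dimension `S.card + 1`, lies in a hyperplane of the functions on `D`,
  -- which gives the second unit of the bound.
  have hrange : LinearMap.range Φ ≤ LinearMap.ker σ := by
    rintro _ ⟨⟨u, c⟩, rfl⟩
    rw [LinearMap.mem_ker, hσ]
    change ∑ x : D, ((∑ s : S, u s * x.1 s) + c) = 0
    rw [Finset.sum_add_distrib, Finset.sum_comm]
    simp only [← Finset.mul_sum, hone, mul_zero, Finset.sum_const_zero, zero_add]
    rw [← mul_one c, ← Finset.mul_sum, hpar, mul_zero]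
  have hsurj : LinearMap.range σ = ⊤ := by
    rw [LinearMap.range_eq_top]
    intro c
    exact ⟨Pi.single hDne.some c, by rw [hσ]; simp⟩
  have hr1 := LinearMap.finrank_range_of_inj hΦ
  have hr2 := Submodule.finrank_mono hrange
  have hr3 := LinearMap.finrank_range_add_finrank_ker σ
  rw [hsurj, finrank_top] at hr3
  simp only [Module.finrank_prod, Module.finrank_fintype_fun_eq_card, Module.finrank_self,
    Fintype.card_coe] at hr1 hr3
  have : D.card = hammingNorm f := rfl
  omega

theorem distToSet_reedMuller_eq {m : ℕ} (hm : 3 ≤ m) (S : Finset (Fin m))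
    (hS : S.card = 2 * (m / 2)) (f : BoolFun m) (hp : parity f = 0)
    (hf : ∀ a b, secondMoment f a b = if a ∈ S ∧ b ∈ S ∧ a ≠ b then 1 else 0) :
    distToSet f (reedMuller (m - 3) m) = 2 * (m / 2) + 2 := by
  refine le_antisymm (distToSet_reedMuller_le hm f).1
    (le_distToSet ⟨0, (reedMullerSubgroup hm).zero_mem⟩ fun c hc => ?_)
  replace hc := (mem_reedMuller_iff hm).mp hc
  rw [hammingDist_eq_hammingNorm_add, ← hS]
  refine le_hammingNorm_of_secondMoment S (hS ▸ even_two_mul _)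
    (Finset.card_pos.mp (by omega)) _ ?_ fun a b => ?_
  · rw [parity_add, hp, hc.1, add_zero]
  · rw [secondMoment_add, hf, hc.2, add_zero]

/-! ### Transvections and invariant groups of matrices. -/

/-- The transvection `x ↦ x + x_j e_i`. -/
def transvect {m : ℕ} (i j : Fin m) (x : Fin m → ZMod 2) : Fin m → ZMod 2 :=
  fun a => x a + if a = i then x j else 0

theorem transvect_involutive {m : ℕ} {i j : Fin m} (h : i ≠ j) :
    Function.Involutive (transvect i j) := by
  intro x
  ext a
  by_cases ha : a = i
  · simp [transvect, ha, h.symm, add_assoc, CharTwo.add_self_eq_zero]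
  · simp [transvect, ha]

theorem hammingDist_comp_perm {ι : Type*} [Fintype ι] (e : Equiv.Perm ι) (f g : ι → ZMod 2) :
    hammingDist (f ∘ e) (g ∘ e) = hammingDist f g :=
  Finset.card_equiv e (by simp)

theorem distToSet_comp_perm {ι : Type*} [Fintype ι] (e : Equiv.Perm ι) (X : Set (ι → ZMod 2))
    (hX : ∀ f, f ∘ e ∈ X ↔ f ∈ X) (f : ι → ZMod 2) : distToSet (f ∘ e) X = distToSet f X := by
  unfold distToSet
  congr 1
  ext n
  constructor
  · rintro ⟨x, hx, rfl⟩
    have hxe : (x ∘ e.symm) ∘ e = x := by ext; simp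
    refine ⟨x ∘ e.symm, (hX _).mp (hxe.symm ▸ hx), ?_⟩
    change hammingDist f (x ∘ e.symm) = hammingDist (f ∘ e) x
    rw [← hammingDist_comp_perm e f, hxe]
  · rintro ⟨x, hx, rfl⟩
    exact ⟨x ∘ e, (hX x).mpr hx, hammingDist_comp_perm e f x⟩

theorem parity_comp {m : ℕ} (e : Equiv.Perm (Fin m → ZMod 2)) (f : BoolFun m) :
    parity (f ∘ e) = parity f :=
  Equiv.sum_comp e f

/-- The matrix `A` becomes `E A Eᵀ` with `E = I + e_i e_jᵀ`; the bracket is the expanded difference.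
-/
theorem secondMoment_comp_transvect {m : ℕ} {i j : Fin m} (h : i ≠ j) (f : BoolFun m)
    (a b : Fin m) :
    secondMoment (f ∘ (transvect_involutive h).toPerm) a b = secondMoment f a b +
      ((if a = i then secondMoment f j b else 0) + (if b = i then secondMoment f a j else 0) +
        if a = i ∧ b = i then secondMoment f j j else 0) := by
  have h1 : secondMoment (f ∘ (transvect_involutive h).toPerm) a b =
      ∑ x, f x * (transvect i j x a * transvect i j x b) := by
    rw [← Equiv.sum_comp (transvect_involutive h).toPerm]
    refine Finset.sum_congr rfl fun x _ => ?_
    simp [transvect_involutive h x]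
  rw [h1]
  by_cases ha : a = i <;> by_cases hb : b = i <;>
    simp only [ha, hb, transvect, secondMoment, if_true, if_false, and_self, and_true, and_false,
      add_zero, zero_add, ← Finset.sum_add_distrib] <;>
    exact Finset.sum_congr rfl fun x _ => by ring

/-- The second moments of the functions of a group `H`. -/
def secondMoments {m : ℕ} (H : AddSubgroup (BoolFun m)) :
    AddSubgroup (Fin m → Fin m → ZMod 2) :=
  H.map
    { toFun := secondMoment
      map_zero' := by ext; simp [secondMoment]
      map_add' := fun f g => by ext; simp [secondMoment_add] }

theorem mem_secondMoments {m : ℕ} {H : AddSubgroup (BoolFun m)} {M : Fin m → Fin m → ZMod 2} :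
    M ∈ secondMoments H ↔ ∃ f ∈ H, secondMoment f = M := Iff.rfl

/-- A nonzero group of symmetric matrices that is invariant under the congruences given by
transvections contains all symmetric matrices `J - I` on a set of coordinates. -/
theorem alternating_mem_of_transvection_invariant {m : ℕ} (hm : 3 ≤ m)
    (K : AddSubgroup (Fin m → Fin m → ZMod 2))
    (hK : ∀ M ∈ K, ∀ i j, i ≠ j → (fun a b => (if a = i then M j b else 0) +
      (if b = i then M a j else 0) + if a = i ∧ b = i then M j j else 0) ∈ K)
    (hsymm : ∀ M ∈ K, ∀ a b, M a b = M b a) {M : Fin m → Fin m → ZMod 2} (hM : M ∈ K)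
    (hM0 : M ≠ 0) (S : Finset (Fin m)) :
    (fun a b => if a ∈ S ∧ b ∈ S ∧ a ≠ b then 1 else 0) ∈ K := by
  have ne : ∀ t : ZMod 2, t ≠ 0 → t = 1 := by decide
  have third : ∀ p q : Fin m, ∃ r, r ≠ p ∧ r ≠ q := by
    intro p q
    obtain ⟨r, -, hr⟩ := Finset.exists_mem_notMem_of_card_lt_card
      (s := {p, q}) (t := (Finset.univ : Finset (Fin m)))
      (Finset.card_le_two.trans_lt (by simp; omega))
    exact ⟨r, by simpa [not_or] using hr⟩
  let w : Fin m → Fin m → Fin m → Fin m → ZMod 2 := fun i k a b =>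
    (if a = i ∧ b = k then 1 else 0) + if a = k ∧ b = i then 1 else 0
  have wcomm : ∀ i k, w i k = w k i := fun i k => by ext a b; exact add_comm _ _
  have h1 : ∃ i k, i ≠ k ∧ w i k ∈ K := by
    obtain ⟨l, j, hlj⟩ : ∃ l j, M l j ≠ 0 := by
      by_contra! h
      exact hM0 (by ext a b; exact h a b)
    obtain ⟨i, hil, hij⟩ := third l j
    obtain ⟨k, hkl, hki⟩ := third l i
    refine ⟨k, i, hki, ?_⟩
    -- The first difference puts the entry `M l j = 1` at `(l, i)`; the second keeps only its copies
    -- at `(k, i)` and `(i, k)`.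
    convert hK _ (hK M hM i j hij) k l hkl using 1
    ext a b
    have h2 := ne _ hlj
    have h3 := (hsymm M hM j l).trans h2
    simp only [w, hil.symm, if_false, h2, h3, false_and, zero_add, add_zero, ite_self, and_false]
    simp only [← ite_and, and_comm]
  have h2 : ∀ i k a, i ≠ k → w i k ∈ K → w a k ∈ K := by
    intro i k a hik h
    by_cases hai : a = i
    · rwa [hai]
    · convert hK _ h a i hai using 1
      ext p q
      simp only [w, hik, if_false, if_true, add_zero, zero_add, ite_self, ite_and]
      simp only [← ite_and, and_comm]
  have h3 : ∀ a b, a ≠ b → w a b ∈ K := by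
    obtain ⟨i, k, hik, h⟩ := h1
    intro a b hab
    by_cases hak : a = k
    · subst hak
      rw [wcomm]
      exact h2 i a b hik h
    · rw [wcomm]
      refine h2 k a b (Ne.symm hak) ?_
      rw [wcomm]
      exact h2 i k a hik h
  have h4 : (∑ p ∈ S, ∑ q ∈ S with q < p, w p q) ∈ K :=
    K.sum_mem fun p _ => K.sum_mem fun q hq => h3 p q (Finset.mem_filter.mp hq).2.ne'
  convert h4 using 1
  ext a b
  have h5 : ∀ p, ∑ q ∈ S with q < p, w p q a b =
      (if a = p then if b ∈ S ∧ b < p then 1 else 0 else 0) +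
        if b = p then if a ∈ S ∧ a < p then 1 else 0 else 0 := by
    intro p
    simp only [w, Finset.sum_add_distrib, ite_and, Finset.sum_ite_irrel, Finset.sum_const_zero,
      Finset.sum_ite_eq, Finset.mem_filter]
    congr 1
    simp only [← ite_and, and_comm, and_assoc]
  simp only [Finset.sum_apply, h5, Finset.sum_add_distrib, Finset.sum_ite_eq]
  rcases lt_trichotomy a b with h | h | h
  · simp [h, h.ne, h.not_gt, and_comm, ← ite_and]
  · simp [h]
  · simp [h, h.ne', h.not_gt, ← ite_and]

/-! ### Metric regularity. -/

/-- The Reed-Muller code of order `m - 3` in `m` variables is metrically regular. -/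
theorem theorem2 (m : ℕ) (hm : 3 ≤ m) : MetricallyRegular (reedMuller (m - 3) m) := by
  obtain ⟨S, -, hS⟩ := Finset.exists_subset_card_eq
    (s := (Finset.univ : Finset (Fin m))) (n := 2 * (m / 2)) (by simp; omega)
  obtain ⟨f₀, hp₀, hf₀, -, -⟩ := exists_parity_secondMoment 0
    (fun a b : Fin m => if a ∈ S ∧ b ∈ S ∧ a ≠ b then 1 else 0)
    (fun a b => by simp only [and_left_comm, and_assoc, and_comm, ne_comm])
  have hdist := distToSet_reedMuller_eq hm S hS
  have hle := distToSet_reedMuller_le hm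
  have hmc := metricComplement_metricComplement (reedMullerSubgroup hm) (fun f => (hle f).1)
    (hdist f₀ hp₀ hf₀)
  change metricComplement (metricComplement (reedMuller (m - 3) m)) = {f | ∀ z,
    distToSet z (reedMuller (m - 3) m) = _ → distToSet (f + z) (reedMuller (m - 3) m) = _} at hmc
  have hzero : distToSet 0 (reedMuller (m - 3) m) = 0 := Nat.le_zero.mp <|
    (distToSet_le (reedMullerSubgroup hm).zero_mem 0).trans_eq (hammingDist_self 0)
  rw [MetricallyRegular, hmc]
  let H : AddSubgroup (BoolFun m) :=
    { carrier := {f | ∀ z, distToSet z (reedMuller (m - 3) m) = 2 * (m / 2) + 2 →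
        distToSet (f + z) (reedMuller (m - 3) m) = 2 * (m / 2) + 2}
      zero_mem' := fun z hz => by rwa [zero_add]
      add_mem' := fun {f g} hf hg z hz => by rw [add_assoc]; exact hf _ (hg z hz)
      neg_mem' := fun {f} hf => by rwa [neg_eq_of_add_eq_zero_left (Pi.add_self_two f)] }
  have hHp : ∀ f ∈ H, parity f = 0 := by
    intro f hf
    by_contra h
    -- If `f` were odd, `f + f₀` would be odd, hence not a deep hole.
    have h1 := hf f₀ (hdist f₀ hp₀ hf₀)
    refine ((hle (f + f₀)).2 ?_).ne h1
    rw [parity_add, hp₀, add_zero]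
    exact (by decide : ∀ t : ZMod 2, t ≠ 0 → t = 1) _ h
  have hHcomp : ∀ f ∈ H, ∀ i j (hij : i ≠ j), f ∘ (transvect_involutive hij).toPerm ∈ H := by
    intro f hf i j hij
    set e := (transvect_involutive hij).toPerm with he
    have hee : ∀ g : BoolFun m, (g ∘ e) ∘ e = g := fun g => by
      ext x
      exact congrArg g (transvect_involutive hij x)
    have hC : ∀ g : BoolFun m, g ∈ reedMuller (m - 3) m → g ∘ e ∈ reedMuller (m - 3) m := by
      intro g hg
      rw [mem_reedMuller_iff hm] at hg ⊢
      exact ⟨by rw [parity_comp, hg.1], fun a b => by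
        simp only [he, secondMoment_comp_transvect hij, hg.2, ite_self, add_zero]⟩
    have hinv := distToSet_comp_perm e (reedMuller (m - 3) m) fun g =>
      ⟨fun h => hee g ▸ hC _ h, hC g⟩
    intro z hz
    have h1 := hf (z ∘ e) ((hinv z).trans hz)
    rw [← hinv] at h1
    have h2 : (f + z ∘ e) ∘ e = f ∘ e + z := by
      conv_rhs => rw [← hee z]
      rfl
    rwa [h2] at h1
  ext f
  constructor
  · intro hf
    by_contra hfC
    have hf0 : secondMoment f ≠ 0 := fun h =>
      hfC ((mem_reedMuller_iff hm).mpr ⟨hHp f hf, fun a b => by rw [h]; rfl⟩)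
    obtain ⟨g, hg, hgM⟩ := mem_secondMoments.mp <|
      alternating_mem_of_transvection_invariant hm (secondMoments H)
      (by
        rintro _ ⟨g, hg, rfl⟩ i j hij
        refine ⟨g ∘ (transvect_involutive hij).toPerm + g,
          H.add_mem (hHcomp g hg i j hij) hg, ?_⟩
        ext a b
        change secondMoment _ a b = _
        rw [secondMoment_add, secondMoment_comp_transvect hij, add_right_comm,
          CharTwo.add_self_eq_zero, zero_add]
        rfl)
      (by rintro _ ⟨g, -, rfl⟩ a b; exact secondMoment_comm g a b) ⟨f, hf, rfl⟩ hf0 S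
    -- Here `g` is a deep hole that also stabilizes the deep holes, so translating it by itself
    -- gives `0`.
    have h1 := hg g (hdist g (hHp g hg) fun a b => by rw [hgM])
    rw [Pi.add_self_two, hzero] at h1
    omega
  · intro hf z hz
    exact (distToSet_add_left (reedMullerSubgroup hm) hf z).trans hz
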